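/- Let $A$ be a finite set and let $F_A$ be the free group on $A$. The profinite topology on $F_A$ is the topology in which, for every $u \in F_A$, the right cosets $Ku$, where $K$ runs over the subgroups of finite index of $F_A$, form a basis of neighbourhoods of $u$. (M. Hall) Every finitely generated subgroup $H$ of $F_A$ is closed in the profinite topology. Moreover, for every such $H$ and every $u \in F_A \setminus H$ there is a subgroup $K$ of finite index in $F_A$ with $H \subseteq K$ and $Ku \cap H = \emptyset$. Consequently $F_A$ is residually finite, that is, the intersection of its normal subgroups of finite index is trivial (equivalently, the intersection of all its subgroups of finite index is trivial). -/

import Mathlib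

open scoped Topology

/-- The right coset `K u = {k u | k ∈ K}` of a subgroup `K` of a group `G`. -/
def rightCosetSet {G : Type*} [Group G] (K : Subgroup G) (u : G) : Set G :=
  {g | ∃ k ∈ K, g = k * u}

theorem mem_rightCosetSet_self {G : Type*} [Group G] (K : Subgroup G) (u : G) :
    u ∈ rightCosetSet K u :=
  ⟨1, K.one_mem, (one_mul u).symm⟩

theorem rightCosetSet_subset_of_mem {G : Type*} [Group G] {K : Subgroup G} {u v : G}
    (h : v ∈ rightCosetSet K u) : rightCosetSet K v ⊆ rightCosetSet K u := by
  rintro g ⟨k, hk, rfl⟩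
  obtain ⟨l, hl, rfl⟩ := h
  exact ⟨k * l, K.mul_mem hk hl, (mul_assoc k l u).symm⟩

theorem rightCosetSet_mono {G : Type*} [Group G] {K L : Subgroup G} (h : K ≤ L) (u : G) :
    rightCosetSet K u ⊆ rightCosetSet L u := by
  rintro g ⟨k, hk, rfl⟩
  exact ⟨k, h hk, rfl⟩

/-- The profinite topology on a (discrete) group `G`: the topology in which the right cosets
`K u`, for `K` ranging over the subgroups of finite index, form a basis of neighbourhoods of `u`,
for every `u`. So a set is open if and only if it contains such a coset around each of its points
(see `hasBasis_nhds_profiniteTopology` and `isClopen_rightCosetSet` below). -/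
@[reducible]
def profiniteTopology (G : Type*) [Group G] : TopologicalSpace G where
  IsOpen U := ∀ u ∈ U, ∃ K : Subgroup G, K.FiniteIndex ∧ rightCosetSet K u ⊆ U
  isOpen_univ _ _ := ⟨⊤, inferInstance, Set.subset_univ _⟩
  isOpen_inter U V hU hV u hu := by
    obtain ⟨K, hK, hKU⟩ := hU u hu.1
    obtain ⟨L, hL, hLV⟩ := hV u hu.2
    exact ⟨K ⊓ L, inferInstance, Set.subset_inter
      ((rightCosetSet_mono inf_le_left u).trans hKU)
      ((rightCosetSet_mono inf_le_right u).trans hLV)⟩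
  isOpen_sUnion S hS u hu := by
    obtain ⟨U, hUS, huU⟩ := hu
    obtain ⟨K, hK, hKU⟩ := hS U hUS u huU
    exact ⟨K, hK, hKU.trans (Set.subset_sUnion_of_mem hUS)⟩

theorem isOpen_rightCosetSet {G : Type*} [Group G] (K : Subgroup G) (hK : K.FiniteIndex) (u : G) :
    IsOpen[profiniteTopology G] (rightCosetSet K u) :=
  fun _ hv => ⟨K, hK, rightCosetSet_subset_of_mem hv⟩

theorem isClopen_rightCosetSet {G : Type*} [Group G] (K : Subgroup G) (hK : K.FiniteIndex)
    (u : G) : @IsClopen G (profiniteTopology G) (rightCosetSet K u) := by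
  let _ := profiniteTopology G
  refine ⟨⟨fun v hv => ⟨K, hK, ?_⟩⟩, isOpen_rightCosetSet K hK u⟩
  rintro g ⟨k, hk, rfl⟩ ⟨l, hl, h⟩
  exact hv ⟨k⁻¹ * l, K.mul_mem (K.inv_mem hk) hl, by rw [mul_assoc, ← h, inv_mul_cancel_left]⟩

theorem hasBasis_nhds_profiniteTopology {G : Type*} [Group G] (u : G) :
    (@nhds G (profiniteTopology G) u).HasBasis
      (fun K : Subgroup G => K.FiniteIndex) (fun K => rightCosetSet K u) := by
  let _ := profiniteTopology G
  refine ⟨fun t => ⟨fun ht => ?_, ?_⟩⟩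
  · obtain ⟨U, hUt, hU, huU⟩ := mem_nhds_iff.1 ht
    obtain ⟨K, hK, hKU⟩ := hU u huU
    exact ⟨K, hK, hKU.trans hUt⟩
  · rintro ⟨K, hK, hKt⟩
    exact mem_nhds_iff.2 ⟨_, hKt, isOpen_rightCosetSet K hK u, mem_rightCosetSet_self K u⟩

/-! `H` is the stabilizer of the base coset in `F_A / H`. Tracing the generators of `H` and the word
`u` from that coset visits a finite set `S` of points. Each letter is a partial injection of `S`,
hence extends to a permutation, and freeness turns these into an action on `S`. There the generators
still fix the base point and `u` still moves it, so its stabilizer is the required `K`. -/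

/-- A finite part of an action of a free group can be completed to an action on a finite set: the
completed action agrees with the given one along all words whose suffixes stay in that part. -/
theorem FreeGroup.exists_hom_perm_of_finite {A X : Type*} [MulAction (FreeGroup A) X]
    (S : Set X) (hS : S.Finite) :
    ∃ φ : FreeGroup A →* Equiv.Perm S, ∀ (x : S) (L : List (A × Bool)),
      (∀ s, s <:+ L → FreeGroup.mk s • (x : X) ∈ S) →
        (φ (FreeGroup.mk L) x : X) = FreeGroup.mk L • (x : X) := by
  classical
  have := hS.fintype
  have key : ∀ a : A, ∃ e : Equiv.Perm S, ∀ x : S,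
      FreeGroup.of a • (x : X) ∈ S → (e x : X) = FreeGroup.of a • (x : X) := by
    intro a
    obtain ⟨e, he⟩ := Set.MapsTo.exists_equiv_extend_of_card_eq (t := S.toFinset)
      (by simp) (s := {x : S | FreeGroup.of a • (x : X) ∈ S})
      (f := fun x : S => FreeGroup.of a • (x : X)) (fun x hx => by simpa using hx)
      (fun x _ y _ hxy => Subtype.ext (MulAction.injective _ hxy))
    exact ⟨e.trans (Equiv.subtypeEquivRight (by simp)), fun x hx => he x hx⟩
  choose e he using key
  refine ⟨FreeGroup.lift e, fun x L => ?_⟩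
  -- In a left action the last letter acts first, so the suffixes of `L` give the points visited.
  induction L with
  | nil => intro _; simp [← FreeGroup.one_eq_mk]
  | cons p L ih =>
    intro h
    have ih := ih fun s hs => h s (hs.trans (List.suffix_cons p L))
    have hp := h _ List.suffix_rfl
    obtain ⟨a, b⟩ := p
    have hmul : FreeGroup.mk ((a, b) :: L) = FreeGroup.mk [(a, b)] * FreeGroup.mk L := by
      simp
    rw [hmul, mul_smul, ← ih] at hp
    rw [hmul, _root_.map_mul, Equiv.Perm.mul_apply, mul_smul, ← ih]
    generalize FreeGroup.lift e (FreeGroup.mk L) x = y at hp ⊢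
    cases b with
    | true =>
      change FreeGroup.of a • (y : X) ∈ S at hp
      change (FreeGroup.lift e (FreeGroup.of a) y : X) = FreeGroup.of a • (y : X)
      rw [FreeGroup.lift_apply_of]
      exact he a y hp
    | false =>
      have hinv : FreeGroup.mk [(a, false)] = (FreeGroup.of a)⁻¹ := rfl
      rw [hinv] at hp ⊢
      -- `e a` is known to agree with `a` at `a⁻¹ • y`, which `hp` places in `S`; invert there.
      have hz := he a ⟨_, hp⟩ (by simp)
      rw [smul_inv_smul] at hz
      rw [_root_.map_inv, FreeGroup.lift_apply_of, Equiv.Perm.inv_eq_iff_eq.2 (Subtype.ext hz).symm]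

/-- Membership in a point stabilizer of a free group action can be tested, on a finite set, by a
subgroup of finite index. -/
theorem FreeGroup.exists_finiteIndex_mem_iff_smul_eq {A X : Type*} [MulAction (FreeGroup A) X]
    (x : X) (T : Set (FreeGroup A)) (hT : T.Finite) :
    ∃ K : Subgroup (FreeGroup A), K.FiniteIndex ∧ ∀ g ∈ T, g ∈ K ↔ g • x = x := by
  classical
  let S : Set X := insert x (⋃ g ∈ T, (fun s : List (A × Bool) => FreeGroup.mk s • x) '' {s | s <:+ g.toWord})
  have hS : S.Finite := by
    refine (hT.biUnion fun g _ => Set.Finite.image _ ?_).insert x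
    exact g.toWord.tails.toFinset.finite_toSet.subset fun s hs => by simpa using hs
  obtain ⟨φ, hφ⟩ := FreeGroup.exists_hom_perm_of_finite (A := A) S hS
  let x₀ : S := ⟨x, Set.mem_insert _ _⟩
  have := hS.to_subtype
  refine ⟨(MulAction.stabilizer (Equiv.Perm S) x₀).comap φ, ⟨?_⟩, fun g hg => ?_⟩
  · rw [Subgroup.index_comap]
    exact Subgroup.FiniteIndex.index_ne_zero
  have h := hφ x₀ g.toWord fun s hs =>
    Set.mem_insert_of_mem _ (Set.mem_biUnion hg ⟨s, hs, rfl⟩)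
  rw [FreeGroup.mk_toWord] at h
  rw [Subgroup.mem_comap, MulAction.mem_stabilizer_iff, Equiv.Perm.smul_def, Subtype.ext_iff, h]

/-- Finitely generated subgroups of free groups are separable. -/
theorem FreeGroup.exists_finiteIndex_ge_notMem {A : Type*} (H : Subgroup (FreeGroup A))
    (hH : H.FG) (u : FreeGroup A) (hu : u ∉ H) :
    ∃ K : Subgroup (FreeGroup A), K.FiniteIndex ∧ H ≤ K ∧ u ∉ K := by
  obtain ⟨T, rfl⟩ := hH
  -- Testing the generators gives `H ≤ K`; testing `u` keeps it outside.
  obtain ⟨K, hK, hmem⟩ := FreeGroup.exists_finiteIndex_mem_iff_smul_eq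
    ((1 : FreeGroup A) : FreeGroup A ⧸ Subgroup.closure (T : Set (FreeGroup A)))
    (insert u (T : Set (FreeGroup A))) (T.finite_toSet.insert u)
  have hiff : ∀ g ∈ insert u (T : Set (FreeGroup A)),
      g ∈ K ↔ g ∈ Subgroup.closure (T : Set (FreeGroup A)) := fun g hg => by
    rw [hmem g hg, ← MulAction.mem_stabilizer_iff, MulAction.stabilizer_quotient]
  refine ⟨K, hK, (Subgroup.closure_le K).2 fun g hg => ?_, fun h => hu ?_⟩
  · exact (hiff g (Set.mem_insert_of_mem _ hg)).2 (Subgroup.subset_closure hg)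
  · exact (hiff u (Set.mem_insert _ _)).1 h

theorem disjoint_rightCosetSet_of_le {G : Type*} [Group G] {H K : Subgroup G} (h : H ≤ K)
    {u : G} (hu : u ∉ K) : Disjoint (rightCosetSet K u) (H : Set G) := by
  rw [Set.disjoint_left]
  rintro _ ⟨k, hk, rfl⟩ hH
  exact hu ((K.mul_mem_cancel_left hk).1 (h hH))

theorem mainTheorem6 {A : Type*} [Finite A] :
    (∀ H : Subgroup (FreeGroup A), H.FG →
      IsClosed[profiniteTopology (FreeGroup A)] (H : Set (FreeGroup A)) ∧
      ∀ u : FreeGroup A, u ∉ H → ∃ K : Subgroup (FreeGroup A),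
        K.FiniteIndex ∧ H ≤ K ∧ Disjoint (rightCosetSet K u) (H : Set (FreeGroup A))) ∧
    Group.ResiduallyFinite (FreeGroup A) := by
  have sep : ∀ H : Subgroup (FreeGroup A), H.FG → ∀ u : FreeGroup A, u ∉ H →
      ∃ K : Subgroup (FreeGroup A),
        K.FiniteIndex ∧ H ≤ K ∧ Disjoint (rightCosetSet K u) (H : Set (FreeGroup A)) := by
    intro H hH u hu
    obtain ⟨K, hK, hHK, huK⟩ := FreeGroup.exists_finiteIndex_ge_notMem H hH u hu
    exact ⟨K, hK, hHK, disjoint_rightCosetSet_of_le hHK huK⟩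
  refine ⟨fun H hH => ⟨?_, sep H hH⟩, ?_⟩
  · let _ := profiniteTopology (FreeGroup A)
    refine ⟨fun u hu => ?_⟩
    obtain ⟨K, hK, -, hd⟩ := sep H hH u hu
    exact ⟨K, hK, Set.subset_compl_iff_disjoint_right.2 hd⟩
  · refine Group.residuallyFinite_iff_exists_finiteIndex.2 fun g hg => ?_
    obtain ⟨K, hK, -, hgK⟩ := FreeGroup.exists_finiteIndex_ge_notMem ⊥ Subgroup.FG.bot g
      (Subgroup.mem_bot.not.2 hg)
    exact ⟨K, hK, hgK⟩
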